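/- Let $n\ge 1$ and let $\mathcal S_1,\dots,\mathcal S_n$ be finite sets of transient states of a Markov jump process with one further, absorbing, state $\star$. For $1\le k\le n$ let $A_k$ be the square matrix of transition rates inside $\mathcal S_k$ (nonnegative off-diagonal entries), for $k<n$ let $D_k\ge 0$ be the matrix of transition rates from $\mathcal S_k$ to $\mathcal S_{k+1}$, and let $D_n\ge 0$ be a matrix such that $D_n\mathbf 1$ is the vector of transition rates from $\mathcal S_n$ to $\star$; there are no other transitions, so $D_k\mathbf 1=-A_k\mathbf 1$ for all $k$. Let $\boldsymbol\alpha$ be a probability vector on $\mathcal S_1$, and let the random vector $\boldsymbol Y=(Y_1,\dots,Y_n)$ have the multivariate phase-type law with density $$f(y_1,\dots,y_n)=\boldsymbol\alpha e^{A_1y_1}D_1e^{A_2y_2}D_2\cdots e^{A_ny_n}D_n\mathbf 1,\qquad y_1,\dots,y_n\ge 0 .$$ Let $p_n$ be the largest dimension of the matrices $A_1,\dots,A_n$, let $-\sigma_n$ be the largest of their dominating eigenvalues (the dominating eigenvalue of a matrix is its eigenvalue with the largest real part; it is real and negative for each $A_k$), and let $\nu_n=\max_{1\le k\le n}\max_{i}(-A_k\mathbf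 1)_i$. Fix $\nu\ge\nu_n$, an integer $p\ge p_n$ and $0<\sigma\le\sigma_n$. Let $\boldsymbol L$ be a random vector with $n$ i.i.d. $\mathrm{Exp}(\nu)$ entries (rate $\nu$) and $\boldsymbol H$ a random vector with $n$ i.i.d. $\mathrm{Erlang}(p,\sigma)$ entries ($p$ stages, each of rate $\sigma$). Then $$\boldsymbol L\le_{\mathrm{st}}\boldsymbol Y\le_{\mathrm{st}}\boldsymbol H$$ in the multivariate usual stochastic order: for every increasing set $\Gamma\subseteq\mathbb R^n$ (that is, $x\in\Gamma$ and $y\ge 0$ componentwise imply $x+y\in\Gamma$), $$\mathbb P(\boldsymbol L\in\Gamma)\le\mathbb P(\boldsymbol Y\in\Gamma)\le\mathbb P(\boldsymbol H\in\Gamma).$$ -/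

import Mathlib

open MeasureTheory ProbabilityTheory Filter Topology
open scoped Matrix

noncomputable section

namespace MultPH

/-- The dominating eigenvalue of a real square matrix: the largest real part of its complex
eigenvalues (for a sub-generator matrix, the eigenvalue with the largest real part is real). -/
def dominatingEigenvalue {ι : Type*} [Fintype ι] [DecidableEq ι] (A : Matrix ι ι ℝ) : ℝ :=
  sSup (Complex.re '' spectrum ℂ (A.map Complex.ofReal))

variable {n : ℕ} {S : Fin (n + 1) → Type*} [∀ k, Fintype (S k)] [∀ k, DecidableEq (S k)]

/-- `(α, A, D)` is a representation of a multivariate phase-type law with `n` components. The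
transient states are `S 0, …, S (n - 1)` (the index `k : Fin n` being read in `Fin (n + 1)` through
`k.castSucc`), `A k` holds the transition rates inside the `k`-th block and `D k` those from that
block to the next one. The last index set `S n` only labels the columns of the last matrix `D`,
whose row sums are the transition rates from the last block to the absorbing state. -/
structure IsRepresentation (α : S 0 → ℝ)
    (A : ∀ k : Fin n, Matrix (S k.castSucc) (S k.castSucc) ℝ)
    (D : ∀ k : Fin n, Matrix (S k.castSucc) (S k.succ) ℝ) : Prop where
  alpha_nonneg : ∀ i, 0 ≤ α i
  alpha_sum : ∑ i, α i = 1
  offDiag_nonneg : ∀ k i j, i ≠ j → 0 ≤ A k i j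
  D_nonneg : ∀ k i j, 0 ≤ D k i j
  /-- the rows of the generator sum to zero -/
  row_sum : ∀ k, A k *ᵥ 1 + D k *ᵥ 1 = 0
  /-- every state `i` of every block is transient: the expected total time spent in `i` when
  starting from `i` is finite -/
  transient : ∀ k i, IntegrableOn (fun t : ℝ => NormedSpace.exp (t • A k) i i) (Set.Ioi 0)

/-- The row vector `α e^{A₁ y₁} D₁ ⋯ e^{A_k y_k} D_k`. -/
def rowVec (α : S 0 → ℝ) (A : ∀ k : Fin n, Matrix (S k.castSucc) (S k.castSucc) ℝ)
    (D : ∀ k : Fin n, Matrix (S k.castSucc) (S k.succ) ℝ) (y : Fin n → ℝ) (k : Fin (n + 1)) :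
    S k → ℝ :=
  Fin.induction (motive := fun k => S k → ℝ) α
    (fun k v => v ᵥ* NormedSpace.exp (y k • A k) ᵥ* D k) k

open Classical in
/-- The joint density `α e^{A₁ y₁} D₁ ⋯ e^{A_n y_n} D_n 1` on the nonnegative orthant
(and `0` elsewhere). -/
def density (α : S 0 → ℝ) (A : ∀ k : Fin n, Matrix (S k.castSucc) (S k.castSucc) ℝ)
    (D : ∀ k : Fin n, Matrix (S k.castSucc) (S k.succ) ℝ) (y : Fin n → ℝ) : ℝ :=
  if ∀ k, 0 ≤ y k then rowVec α A D y (Fin.last n) ⬝ᵥ 1 else 0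

/-- The multivariate phase-type law with representation `(α, A, D)`. -/
def law (α : S 0 → ℝ) (A : ∀ k : Fin n, Matrix (S k.castSucc) (S k.castSucc) ℝ)
    (D : ∀ k : Fin n, Matrix (S k.castSucc) (S k.succ) ℝ) : Measure (Fin n → ℝ) :=
  volume.withDensity fun y => ENNReal.ofReal (density α A D y)

/-- The largest dimension of the matrices `A₁, …, A_n`. -/
def maxDim (S : Fin (n + 1) → Type*) [∀ k, Fintype (S k)] : ℕ :=
  Finset.univ.sup fun k : Fin n => Fintype.card (S k.castSucc)

/-- The largest of the dominating eigenvalues of `A₁, …, A_n`. -/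
def maxDominatingEigenvalue (A : ∀ k : Fin n, Matrix (S k.castSucc) (S k.castSucc) ℝ) : ℝ :=
  ⨆ k, dominatingEigenvalue (A k)

/-- The largest entry of the exit rate vectors `-A_k 1`. -/
def maxExitRate (A : ∀ k : Fin n, Matrix (S k.castSucc) (S k.castSucc) ℝ) : ℝ :=
  ⨆ ki : (k : Fin n) × S k.castSucc, (-(A ki.1 *ᵥ 1)) ki.2

/-- The Erlang law with `p` stages of rate `σ`. -/
def erlangMeasure (p : ℕ) (σ : ℝ) : Measure ℝ := gammaMeasure p σ

/-- The multivariate usual stochastic order between laws on `ℝⁿ`: comparison on all increasing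
sets. (Increasing sets are Lebesgue measurable up to null sets; for laws with a density the
inequality compares the integrals of the densities, see `stochLE_withDensity_iff`.) -/
def StochLE (μ ν : Measure (Fin n → ℝ)) : Prop :=
  ∀ Γ : Set (Fin n → ℝ), IsUpperSet Γ → μ Γ ≤ ν Γ

theorem stochLE_withDensity_iff (f g : (Fin n → ℝ) → ENNReal) :
    StochLE (volume.withDensity f) (volume.withDensity g) ↔
      ∀ Γ : Set (Fin n → ℝ), IsUpperSet Γ → ∫⁻ x in Γ, f x ≤ ∫⁻ x in Γ, g x := by
  simp only [StochLE, withDensity_apply']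

end MultPH

end

/-! Given the time `t` spent in the first block, the remaining components have a law of the same
type, started from `α e^{tA₁} D₁`. An induction on `n` thus reduces both comparisons to the tail
`v e^{tA} 1` of the time spent in one block entered with law `v`, at the cost of working with
unnormalised initial laws.

The exit rates are at most `ν`, so `(A + ν) 1 ≥ 0` and `e^{tA} 1 ≥ e^{-νt} 1`.

For the upper bound one needs `e^{tA} 1 ≤ e^{-σt} ∑_{k < m} (σt)^k / k! 1` for a block with `m`
states. By continuity `σ` may be taken smaller than minus the dominating eigenvalue, and then
`M = A + σ` satisfies `M h ≤ 0` for some `h > 0`. As `1 = (σ - M)⁻¹ (-A 1)` with `-A 1 ≥ 0`, it is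
enough that `(σ - M)⁻¹ e^{tM} ≤ (∑_{k < m} (σt)^k / k!) (σ - M)⁻¹` entrywise. This is proved by
induction on `m`: the diagonal entries of the left side never exceed those of `(σ - M)⁻¹`, and the
rest of row `i` is governed by the matrix `M` with state `i` deleted, whose Green matrix is related
to that of `M` by decomposing paths into excursions away from `i`.
-/

namespace MultPH

section Resolvent

variable {𝕜 R : Type*} [Field 𝕜] [Ring R] [Algebra 𝕜 R] {a : R} {s : 𝕜}

theorem mul_resolvent (h : s ∈ resolventSet 𝕜 a) :
    a * resolvent a s = s • resolvent a s - 1 := by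
  have h_inv := Ring.mul_inverse_cancel _ (spectrum.mem_resolventSet_iff.1 h)
  rw [sub_mul, ← Algebra.smul_def] at h_inv
  rw [← h_inv]
  exact (sub_sub_cancel _ _).symm

theorem resolvent_mul (h : s ∈ resolventSet 𝕜 a) :
    resolvent a s * a = s • resolvent a s - 1 := by
  have h_inv := Ring.inverse_mul_cancel _ (spectrum.mem_resolventSet_iff.1 h)
  rw [mul_sub, ← Algebra.commutes, ← Algebra.smul_def] at h_inv
  rw [← h_inv]
  exact (sub_sub_cancel _ _).symm

end Resolvent

section GreenMatrix

/-- The matrix `A` with row and column `i` deleted: the process killed when it enters `i`. -/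
abbrev deleteState {R ι : Type*} (A : Matrix ι ι R) (i : ι) :
    Matrix {j // j ≠ i} {j // j ≠ i} R :=
  A.submatrix Subtype.val Subtype.val

variable {𝕜 ι : Type*} [Field 𝕜] [Fintype ι] [DecidableEq ι] {A : Matrix ι ι 𝕜} {s : 𝕜}

/-- The Green matrix `(s - A)⁻¹` of `A` at level `s`, i.e. the resolvent of `A` read as a matrix
(it is `0` if `s` is in the spectrum of `A`). For a sub-generator `A`, its `(i, j)` entry at level
`0` is the expected total time spent in `j` when starting from `i`. -/
noncomputable abbrev greenMatrix (A : Matrix ι ι 𝕜) (s : 𝕜) : Matrix ι ι 𝕜 :=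
  resolvent A s

theorem commute_greenMatrix (hs : s ∈ resolventSet 𝕜 A) : Commute A (greenMatrix A s) :=
  (mul_resolvent hs).trans (resolvent_mul hs).symm

theorem mulVec_greenMatrix_col (hs : s ∈ resolventSet 𝕜 A) (i j : ι) :
    (A *ᵥ fun k => greenMatrix A s k j) i = s * greenMatrix A s i j - (1 : Matrix ι ι 𝕜) i j := by
  change (A * greenMatrix A s) i j = _
  rw [mul_resolvent hs]
  simp

theorem mulVec_greenMatrix_one (hs : s ∈ resolventSet 𝕜 A) (i : ι) :
    (A *ᵥ greenMatrix A s *ᵥ 1) i = s * (greenMatrix A s *ᵥ 1) i - 1 := by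
  rw [Matrix.mulVec_mulVec, mul_resolvent hs, Matrix.sub_mulVec, Matrix.smul_mulVec]
  simp

theorem vecMul_greenMatrix_eq_iff (hs : s ∈ resolventSet 𝕜 A) {v w : ι → 𝕜} :
    v ᵥ* greenMatrix A s = w ↔ v = s • w - w ᵥ* A := by
  constructor
  · rintro rfl
    rw [Matrix.vecMul_vecMul, resolvent_mul hs, Matrix.vecMul_sub, Matrix.vecMul_smul]
    simp
  · rintro rfl
    rw [Matrix.sub_vecMul, Matrix.vecMul_vecMul, mul_resolvent hs, Matrix.vecMul_sub,
      Matrix.vecMul_smul, Matrix.smul_vecMul]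
    simp

theorem vecMul_comp_val (v : ι → 𝕜) (B : Matrix ι ι 𝕜) (i : ι) :
    ((v ᵥ* B) ∘ Subtype.val : {j // j ≠ i} → 𝕜) =
      v i • (B i ∘ Subtype.val) + (v ∘ Subtype.val) ᵥ* deleteState B i :=
  funext fun j => Fintype.sum_eq_add_sum_subtype_ne (fun k => v k * B k j) i

theorem greenMatrix_row_vecMul_comp_val (hs : s ∈ resolventSet 𝕜 A) (i : ι) :
    ((greenMatrix A s i ᵥ* A) ∘ Subtype.val : {j // j ≠ i} → 𝕜) =
      s • (greenMatrix A s i ∘ Subtype.val) := by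
  ext j
  change (greenMatrix A s * A) i j = _
  rw [resolvent_mul hs]
  simp [Matrix.one_apply_ne j.2.symm]

/-- Every visit to a state other than `i` belongs to an excursion that starts with a jump out of
`i`. -/
theorem greenMatrix_row_eq {i : ι} (hs : s ∈ resolventSet 𝕜 A)
    (hs' : s ∈ resolventSet 𝕜 (deleteState A i)) :
    (greenMatrix A s i ∘ Subtype.val : {j // j ≠ i} → 𝕜) =
      greenMatrix A s i i • ((A i ∘ Subtype.val) ᵥ* greenMatrix (deleteState A i) s) := by
  rw [← Matrix.smul_vecMul, eq_comm, vecMul_greenMatrix_eq_iff hs',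
    ← greenMatrix_row_vecMul_comp_val hs, vecMul_comp_val, add_sub_cancel_right]

end GreenMatrix

section Metzler

variable {𝕜 ι κ : Type*} [Field 𝕜] [LinearOrder 𝕜]

/-- A Metzler matrix: a square matrix with nonnegative off-diagonal entries. The transition rates
inside a set of states of a Markov jump process form such a matrix. -/
def IsMetzler (A : Matrix ι ι 𝕜) : Prop :=
  ∀ i j, i ≠ j → 0 ≤ A i j

variable {A : Matrix ι ι 𝕜} {h : ι → 𝕜} {s : 𝕜}

theorem IsMetzler.submatrix (hA : IsMetzler A) {e : κ → ι} (he : Function.Injective e) :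
    IsMetzler (A.submatrix e e) :=
  fun i j hij => hA (e i) (e j) (he.ne hij)

theorem IsMetzler.add_smul_one [DecidableEq ι] (hA : IsMetzler A) (c : 𝕜) :
    IsMetzler (A + c • 1) := fun i j hij => by
  simpa [Matrix.one_apply_ne hij] using hA i j hij

variable [IsStrictOrderedRing 𝕜] [Fintype ι]

theorem mulVec_mono {m : Type*} {B : Matrix m ι 𝕜} (hB : ∀ i j, 0 ≤ B i j) {v w : ι → 𝕜}
    (hvw : v ≤ w) : B *ᵥ v ≤ B *ᵥ w :=
  fun i => Finset.sum_le_sum fun j _ => mul_le_mul_of_nonneg_left (hvw j) (hB i j)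

theorem IsMetzler.submatrix_mulVec_le (hA : IsMetzler A) [Fintype κ] {e : κ → ι}
    (he : Function.Injective e) (hh : 0 ≤ h) (k : κ) :
    (A.submatrix e e *ᵥ (h ∘ e)) k ≤ (A *ᵥ h) (e k) := by
  classical
  calc (A.submatrix e e *ᵥ (h ∘ e)) k = ∑ j ∈ Finset.univ.map ⟨e, he⟩, A (e k) j * h j := by
        simp [Matrix.mulVec, dotProduct]
    _ ≤ (A *ᵥ h) (e k) := by
        refine Finset.sum_le_sum_of_subset_of_nonneg (Finset.subset_univ _) fun j _ hj => ?_
        refine mul_nonneg (hA _ _ fun hkj => hj ?_) (hh j)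
        simp [← hkj]

/-- Minimum principle: a negative minimum of `x / h` would violate `A h < s h` there. -/
theorem IsMetzler.nonneg_of_mulVec_le (hA : IsMetzler A) (hh : ∀ i, 0 < h i)
    (hAh : ∀ i, (A *ᵥ h) i < s * h i) {x : ι → 𝕜}
    (hx : ∀ i, 0 ≤ x i ∨ (A *ᵥ x) i ≤ s * x i) : 0 ≤ x := by
  intro i
  have : Nonempty ι := ⟨i⟩
  obtain ⟨k, hk⟩ := Finite.exists_min fun j => x j / h j
  suffices hxk : 0 ≤ x k by
    simpa using (le_div_iff₀ (hh i)).1 ((div_nonneg hxk (hh k).le).trans (hk i))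
  by_contra! hxk
  set q := x k / h k
  have hq : q < 0 := div_neg_of_neg_of_pos hxk (hh k)
  have hxk_eq : x k = q * h k := (div_mul_cancel₀ _ (hh k).ne').symm
  have h_row : q * (A *ᵥ h) k ≤ (A *ᵥ x) k := by
    simp only [Matrix.mulVec, dotProduct, Finset.mul_sum]
    refine Finset.sum_le_sum fun j _ => ?_
    rcases eq_or_ne k j with rfl | hkj
    · rw [hxk_eq]; exact le_of_eq (by ring)
    · nlinarith [mul_le_mul_of_nonneg_left ((le_div_iff₀ (hh j)).1 (hk j)) (hA k j hkj)]
  have h_exit := (hx k).resolve_left hxk.not_ge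
  rw [hxk_eq] at h_exit
  linarith [mul_lt_mul_of_neg_left (hAh k) hq]

theorem IsMetzler.pos_of_mulVec_lt (hA : IsMetzler A) {x : ι → 𝕜} (hx : 0 ≤ x)
    (hAx : ∀ i, (A *ᵥ x) i < s * x i) (i : ι) : 0 < x i := by
  refine (hx i).lt_of_ne' fun (hxi : x i = 0) => ?_
  have h_nonneg : 0 ≤ (A *ᵥ x) i := Finset.sum_nonneg fun j _ => by
    rcases eq_or_ne i j with rfl | hij
    · simp [hxi]
    · exact mul_nonneg (hA i j hij) (hx j)
  have := hAx i
  rw [hxi, mul_zero] at this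
  exact this.not_ge h_nonneg

variable [DecidableEq ι]

theorem IsMetzler.mem_resolventSet (hA : IsMetzler A) (hh : ∀ i, 0 < h i)
    (hAh : ∀ i, (A *ᵥ h) i < s * h i) : s ∈ resolventSet 𝕜 A := by
  rw [spectrum.mem_resolventSet_iff, Matrix.isUnit_iff_isUnit_det, isUnit_iff_ne_zero]
  intro h_det
  obtain ⟨x, hx_ne, hx⟩ := Matrix.exists_mulVec_eq_zero_iff.2 h_det
  have h_eig : A *ᵥ x = s • x := by
    rw [Matrix.sub_mulVec, Algebra.algebraMap_eq_smul_one, Matrix.smul_mulVec,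
      Matrix.one_mulVec, sub_eq_zero] at hx
    exact hx.symm
  have hx_nonneg : 0 ≤ x := hA.nonneg_of_mulVec_le hh hAh fun i => Or.inr (by simp [h_eig])
  have hx_nonpos : 0 ≤ -x :=
    hA.nonneg_of_mulVec_le hh hAh fun i => Or.inr (by simp [Matrix.mulVec_neg, h_eig])
  exact hx_ne (le_antisymm (neg_nonneg.1 hx_nonpos) hx_nonneg)

theorem IsMetzler.greenMatrix_nonneg (hA : IsMetzler A) (hh : ∀ i, 0 < h i)
    (hAh : ∀ i, (A *ᵥ h) i < s * h i) (i j : ι) : 0 ≤ greenMatrix A s i j :=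
  hA.nonneg_of_mulVec_le hh hAh (x := fun k => greenMatrix A s k j)
    (fun k => Or.inr <| by
      rw [mulVec_greenMatrix_col (hA.mem_resolventSet hh hAh)]
      exact sub_le_self _ (by rw [Matrix.one_apply]; split_ifs <;> norm_num)) i

theorem IsMetzler.greenMatrix_mul_le (hA : IsMetzler A) (hh : ∀ i, 0 < h i)
    (hAh : ∀ i, (A *ᵥ h) i < s * h i) (i j : ι) :
    greenMatrix A s i j * h j ≤ h i * greenMatrix A s j j := by
  have h_diff : 0 ≤ greenMatrix A s j j • h - h j • fun k => greenMatrix A s k j := by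
    refine hA.nonneg_of_mulVec_le hh hAh fun k => ?_
    rcases eq_or_ne k j with rfl | hkj
    · exact Or.inl (by simp [mul_comm])
    · right
      rw [Matrix.mulVec_sub, Matrix.mulVec_smul, Matrix.mulVec_smul]
      have hAh_k := mul_le_mul_of_nonneg_left (hAh k).le (hA.greenMatrix_nonneg hh hAh j j)
      simp only [Pi.sub_apply, Pi.smul_apply, smul_eq_mul,
        mulVec_greenMatrix_col (hA.mem_resolventSet hh hAh), Matrix.one_apply_ne hkj]
      linarith
  have := h_diff i
  simp only [Pi.zero_apply, Pi.sub_apply, Pi.smul_apply, smul_eq_mul] at this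
  linarith

end Metzler

section Perron

variable {ι : Type*} [Fintype ι] {A : Matrix ι ι ℝ} {a s : ℝ}

theorem isOpen_setOf_exists_pos_mulVec_lt (A : Matrix ι ι ℝ) :
    IsOpen {s : ℝ | ∃ h : ι → ℝ, (∀ i, 0 < h i) ∧ ∀ i, (A *ᵥ h) i < s * h i} := by
  refine isOpen_iff_mem_nhds.2 ?_
  rintro s ⟨h, hh, hAh⟩
  have h_near : ∀ᶠ t in 𝓝 s, ∀ i, (A *ᵥ h) i < t * h i := eventually_all.2 fun i =>
    (continuous_mul_const (h i)).continuousAt.eventually_const_lt (hAh i)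
  exact h_near.mono fun t ht => ⟨h, hh, ht⟩

variable [DecidableEq ι]

open scoped Matrix.Norms.Operator in
theorem continuousAt_greenMatrix (hs : s ∈ resolventSet ℝ A) : ContinuousAt (greenMatrix A) s :=
  (spectrum.hasDerivAt_resolvent_const_left hs).continuousAt

/-- The vector `(s - A)⁻¹ 1` is a witness as soon as it is nonnegative, which is a closed condition
on `s`, whereas having a witness is an open one. -/
theorem IsMetzler.exists_pos_mulVec_lt (hA : IsMetzler A)
    (ha : Set.Ici a ⊆ resolventSet ℝ A) :
    ∃ h : ι → ℝ, (∀ i, 0 < h i) ∧ ∀ i, (A *ᵥ h) i < a * h i := by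
  let U := {s : ℝ | ∃ h : ι → ℝ, (∀ i, 0 < h i) ∧ ∀ i, (A *ᵥ h) i < s * h i}
  have h_large : (Set.Ici a ∩ U).Nonempty := by
    obtain ⟨s, hs⟩ := Finite.exists_le fun i => (A *ᵥ 1) i
    refine ⟨max a (s + 1), Set.mem_Ici.2 (le_max_left _ _), 1, fun _ => one_pos, fun i => ?_⟩
    rw [Pi.one_apply, mul_one]
    exact ((hs i).trans_lt (lt_add_one s)).trans_le (le_max_right _ _)
  have h_closed : closure U ∩ Set.Ici a ⊆ U := by
    rintro s ⟨hsU, hs⟩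
    have h_nonneg : 0 ≤ greenMatrix A s *ᵥ 1 := fun i => by
      have h_cont : ContinuousAt (fun s => (greenMatrix A s *ᵥ 1) i) s :=
        (Continuous.continuousAt (by fun_prop :
          Continuous fun G : Matrix ι ι ℝ => (G *ᵥ 1) i)).comp (continuousAt_greenMatrix (ha hs))
      refine ge_of_tendsto_of_frequently h_cont ((mem_closure_iff_frequently.1 hsU).mono ?_)
      rintro s' ⟨h, hh, hAh⟩
      exact Finset.sum_nonneg fun j _ =>
        mul_nonneg (hA.greenMatrix_nonneg hh hAh i j) zero_le_one
    have h_lt (i : ι) : (A *ᵥ greenMatrix A s *ᵥ 1) i < s * (greenMatrix A s *ᵥ 1) i := by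
      rw [mulVec_greenMatrix_one (ha hs)]
      exact sub_one_lt _
    exact ⟨_, hA.pos_of_mulVec_lt h_nonneg h_lt, h_lt⟩
  exact isPreconnected_Ici.subset_of_closure_inter_subset
    (isOpen_setOf_exists_pos_mulVec_lt A) h_large h_closed Set.self_mem_Ici

theorem mem_resolventSet_of_dominatingEigenvalue_lt (hs : dominatingEigenvalue A < s) :
    s ∈ resolventSet ℝ A := by
  by_contra h_spec
  have h_root : (A.map Complex.ofReal).charpoly.IsRoot s := by
    have h_real := Matrix.mem_spectrum_iff_isRoot_charpoly.1 h_spec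
    rw [show A.map Complex.ofReal = A.map Complex.ofRealHom from rfl, Matrix.charpoly_map]
    exact h_real.map
  refine hs.not_ge (le_csSup ((Matrix.finite_spectrum _).image _).bddAbove ?_)
  exact ⟨s, Matrix.mem_spectrum_iff_isRoot_charpoly.2 h_root, Complex.ofReal_re s⟩

theorem IsMetzler.exists_pos_mulVec_lt_of_dominatingEigenvalue_lt (hA : IsMetzler A)
    (hs : dominatingEigenvalue A < s) :
    ∃ h : ι → ℝ, (∀ i, 0 < h i) ∧ ∀ i, (A *ᵥ h) i < s * h i :=
  hA.exists_pos_mulVec_lt fun _ ht =>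
    mem_resolventSet_of_dominatingEigenvalue_lt (hs.trans_le ht)

theorem IsMetzler.exists_exitRate_pos [Nonempty ι] (hA : IsMetzler A)
    (h_dom : dominatingEigenvalue A < 0) : ∃ i, 0 < (-(A *ᵥ 1)) i := by
  by_contra! h_exit
  obtain ⟨h, hh, hAh⟩ := hA.exists_pos_mulVec_lt_of_dominatingEigenvalue_lt h_dom
  have h_neg : (0 : ι → ℝ) ≤ -1 := hA.nonneg_of_mulVec_le hh hAh fun i => Or.inr <| by
    rw [Matrix.mulVec_neg, zero_mul]
    exact h_exit i
  have := h_neg (Classical.arbitrary ι)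
  norm_num at this

end Perron

section Exponential

variable {ι : Type*} [Fintype ι]

theorem le_of_hasDerivAt_nonpos {f f' : ℝ → ℝ} {t : ℝ} (ht : 0 ≤ t)
    (hf : ∀ u, HasDerivAt f (f' u) u) (hf' : ∀ u ∈ Set.Icc 0 t, f' u ≤ 0) : f t ≤ f 0 :=
  antitoneOn_of_hasDerivWithinAt_nonpos (convex_Icc 0 t) (HasDerivAt.continuousOn fun u _ => hf u)
    (fun u _ => (hf u).hasDerivWithinAt) (fun u hu => hf' u (interior_subset hu))
    (Set.left_mem_Icc.2 ht) (Set.right_mem_Icc.2 ht) ht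

theorem hasDerivAt_dotProduct {v w : ℝ → ι → ℝ} {v' w' : ι → ℝ} {t : ℝ}
    (hv : HasDerivAt v v' t) (hw : HasDerivAt w w' t) :
    HasDerivAt (fun u => v u ⬝ᵥ w u) (v' ⬝ᵥ w t + v t ⬝ᵥ w') t := by
  simp only [dotProduct, ← Finset.sum_add_distrib]
  exact HasDerivAt.fun_sum fun i _ => (hasDerivAt_pi.1 hv i).mul (hasDerivAt_pi.1 hw i)

variable [DecidableEq ι] {A : Matrix ι ι ℝ} {t : ℝ}

open scoped Matrix.Norms.Operator in
theorem hasDerivAt_exp_apply (A : Matrix ι ι ℝ) (t : ℝ) (i j : ι) :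
    HasDerivAt (fun u : ℝ => NormedSpace.exp (u • A) i j) ((NormedSpace.exp (t • A) * A) i j) t :=
  hasDerivAt_pi.1 (hasDerivAt_pi.1 (hasDerivAt_exp_smul_const A t) i) j

theorem hasDerivAt_exp_mulVec (A : Matrix ι ι ℝ) (w : ι → ℝ) (t : ℝ) :
    HasDerivAt (fun u : ℝ => NormedSpace.exp (u • A) *ᵥ w)
      (NormedSpace.exp (t • A) *ᵥ (A *ᵥ w)) t := by
  rw [Matrix.mulVec_mulVec]
  exact hasDerivAt_pi.2 fun i => HasDerivAt.fun_sum fun j _ =>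
    (hasDerivAt_exp_apply A t i j).mul_const (w j)

theorem hasDerivAt_vecMul_exp (A : Matrix ι ι ℝ) (v : ι → ℝ) (t : ℝ) :
    HasDerivAt (fun u : ℝ => v ᵥ* NormedSpace.exp (u • A))
      (v ᵥ* NormedSpace.exp (t • A) ᵥ* A) t := by
  rw [Matrix.vecMul_vecMul]
  exact hasDerivAt_pi.2 fun j => HasDerivAt.fun_sum fun i _ =>
    (hasDerivAt_exp_apply A t i j).const_mul (v i)

theorem continuous_exp_smul (A : Matrix ι ι ℝ) :
    Continuous fun t : ℝ => NormedSpace.exp (t • A) :=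
  continuous_pi fun i => continuous_pi fun j =>
    continuous_iff_continuousAt.2 fun t => (hasDerivAt_exp_apply A t i j).continuousAt

open scoped Matrix.Norms.Operator in
theorem commute_exp_smul {B : Matrix ι ι ℝ} (h : Commute A B) (t : ℝ) :
    Commute (NormedSpace.exp (t • A)) B :=
  (h.smul_left t).exp_left

theorem exp_smul_add_smul_one (A : Matrix ι ι ℝ) (c t : ℝ) :
    NormedSpace.exp (t • (A + c • 1)) = Real.exp (t * c) • NormedSpace.exp (t • A) := by
  have h_comm : Commute (t • A) ((t * c) • 1) := (Commute.one_right _).smul_right _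
  rw [smul_add, smul_smul, Matrix.exp_add_of_commute _ _ h_comm, Matrix.smul_one_eq_diagonal,
    Matrix.exp_diagonal, Pi.exp_def, ← Real.exp_eq_exp_ℝ, ← Matrix.smul_one_eq_diagonal,
    mul_smul_comm, mul_one]

theorem pow_apply_nonneg (hA : ∀ i j, 0 ≤ A i j) (n : ℕ) (i j : ι) : 0 ≤ (A ^ n) i j := by
  induction n generalizing j with
  | zero => rw [pow_zero, Matrix.one_apply]; split_ifs <;> norm_num
  | succ n ih =>
    rw [pow_succ, Matrix.mul_apply]
    exact Finset.sum_nonneg fun k _ => mul_nonneg (ih k) (hA k j)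

open scoped Matrix.Norms.Operator in
theorem exp_apply_nonneg (hA : ∀ i j, 0 ≤ A i j) (i j : ι) : 0 ≤ NormedSpace.exp A i j :=
  HasSum.nonneg (fun n => mul_nonneg (by positivity) (pow_apply_nonneg hA n i j)) <|
    Pi.hasSum.1 (Pi.hasSum.1 (NormedSpace.exp_series_hasSum_exp' (𝕂 := ℝ) A) i) j

theorem IsMetzler.exp_smul_nonneg (hA : IsMetzler A) (ht : 0 ≤ t) (i j : ι) :
    0 ≤ NormedSpace.exp (t • A) i j := by
  obtain ⟨c, hc⟩ := Finite.exists_ge fun i => A i i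
  have h_shift (i j : ι) : 0 ≤ (A + (-c) • 1) i j := by
    rcases eq_or_ne i j with rfl | hij
    · simpa using hc i
    · exact hA.add_smul_one (-c) i j hij
  have h_exp := exp_apply_nonneg (A := t • (A + (-c) • 1))
    (fun i j => mul_nonneg ht (h_shift i j)) i j
  rw [exp_smul_add_smul_one] at h_exp
  exact nonneg_of_mul_nonneg_right h_exp (Real.exp_pos _)

theorem IsMetzler.exp_smul_mulVec_le (hA : IsMetzler A) (ht : 0 ≤ t) {h : ι → ℝ}
    (hAh : A *ᵥ h ≤ 0) : NormedSpace.exp (t • A) *ᵥ h ≤ h := by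
  intro i
  have h_le := le_of_hasDerivAt_nonpos ht
    (fun u => hasDerivAt_pi.1 (hasDerivAt_exp_mulVec A h u) i) fun u hu => by
      simpa using mulVec_mono (hA.exp_smul_nonneg hu.1) hAh i
  simpa using h_le

theorem IsMetzler.le_exp_smul_mulVec (hA : IsMetzler A) (ht : 0 ≤ t) {h : ι → ℝ}
    (hAh : 0 ≤ A *ᵥ h) : h ≤ NormedSpace.exp (t • A) *ᵥ h := by
  have h_neg : A *ᵥ (-h) ≤ 0 := by rwa [Matrix.mulVec_neg, neg_nonpos]
  simpa [Matrix.mulVec_neg] using hA.exp_smul_mulVec_le ht h_neg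

/-- The function `u ↦ d u ⬝ᵥ e^{(t - u) M} e_j + P (t - u)` is nonincreasing on `[0, t]`. -/
theorem IsMetzler.apply_le_of_hasDerivAt_le {M : Matrix ι ι ℝ} (hM : IsMetzler M)
    {d d' : ℝ → ι → ℝ} {g : ι → ℝ} {P P' : ℝ → ℝ} {j : ι} (ht : 0 ≤ t)
    (hd : ∀ u, HasDerivAt d (d' u) u) (hP : ∀ u, HasDerivAt P (P' u) u)
    (hd₀ : d 0 = 0) (hP₀ : P 0 = 0) (hd' : ∀ u ∈ Set.Icc 0 t, d' u ≤ d u ᵥ* M + g)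
    (hgP : ∀ u ∈ Set.Icc 0 t, (g ᵥ* NormedSpace.exp (u • M)) j ≤ P' u) : d t j ≤ P t := by
  set E : ℝ → ι → ℝ := fun u => NormedSpace.exp (u • M) *ᵥ Pi.single j 1
  have h_dot (v : ι → ℝ) (u : ℝ) : v ⬝ᵥ E u = (v ᵥ* NormedSpace.exp (u • M)) j := by
    rw [Matrix.dotProduct_mulVec, dotProduct_single_one]
  have hE (u : ℝ) : HasDerivAt (fun u => E (t - u)) (-(M *ᵥ E (t - u))) u := by
    have h_exp := hasDerivAt_exp_mulVec M (Pi.single j 1) (t - u)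
    rw [Matrix.mulVec_mulVec, (commute_exp_smul (Commute.refl M) _).eq,
      ← Matrix.mulVec_mulVec] at h_exp
    simpa [E, Function.comp_def] using h_exp.scomp u ((hasDerivAt_id u).const_sub t)
  have h_deriv (u : ℝ) := (hasDerivAt_dotProduct (hd u) (hE u)).add
    ((hP (t - u)).comp u ((hasDerivAt_id u).const_sub t))
  have h_le := le_of_hasDerivAt_nonpos ht h_deriv fun u hu => ?_
  · simpa [h_dot, hd₀, hP₀] using h_le
  · have hu' : t - u ∈ Set.Icc 0 t := ⟨sub_nonneg.2 hu.2, sub_le_self _ hu.1⟩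
    have hE_nonneg : 0 ≤ E (t - u) := fun k => by
      simpa [E] using hM.exp_smul_nonneg hu'.1 k j
    have h_drift := dotProduct_le_dotProduct_of_nonneg_right (hd' u hu) hE_nonneg
    have h_source : g ⬝ᵥ E (t - u) ≤ P' (t - u) :=
      (h_dot g _).trans_le (hgP _ hu')
    rw [add_dotProduct, ← Matrix.dotProduct_mulVec] at h_drift
    rw [dotProduct_neg]
    linarith

end Exponential

section ExpPartialSum

/-- The partial sum `∑ k < m, x ^ k / k!` of the exponential series. -/
noncomputable def expPartialSum (m : ℕ) (x : ℝ) : ℝ :=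
  ∑ k ∈ Finset.range m, x ^ k / k.factorial

theorem expPartialSum_succ_zero (m : ℕ) : expPartialSum (m + 1) 0 = 1 := by
  simp [expPartialSum, Finset.sum_range_succ']

theorem expPartialSum_mono {x : ℝ} (hx : 0 ≤ x) : Monotone fun m => expPartialSum m x :=
  monotone_nat_of_le_succ fun m => by
    simpa [expPartialSum, Finset.sum_range_succ] using by positivity

theorem one_le_expPartialSum_succ (m : ℕ) {x : ℝ} (hx : 0 ≤ x) : 1 ≤ expPartialSum (m + 1) x := by
  simpa [expPartialSum] using expPartialSum_mono hx (Nat.le_add_left 1 m)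

theorem hasDerivAt_expPartialSum_succ (m : ℕ) (x : ℝ) :
    HasDerivAt (expPartialSum (m + 1)) (expPartialSum m x) x := by
  have h_sum : expPartialSum (m + 1) =
      fun x : ℝ => (∑ k ∈ Finset.range m, x ^ (k + 1) / (k + 1).factorial) + 1 := by
    ext x
    simp [expPartialSum, Finset.sum_range_succ' _ m]
  rw [h_sum]
  refine (HasDerivAt.fun_sum fun k _ => ?_).add_const 1
  refine ((hasDerivAt_pow (k + 1) x).div_const _).congr_deriv ?_
  rw [Nat.factorial_succ, Nat.cast_mul, Nat.add_sub_cancel, mul_div_mul_left _ _ (by positivity)]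

end ExpPartialSum

section ErlangBound

variable {ι : Type*} [Fintype ι] {M : Matrix ι ι ℝ} {h : ι → ℝ} {σ t : ℝ}

theorem mulVec_lt_of_nonpos (hh : ∀ i, 0 < h i) (hMh : M *ᵥ h ≤ 0) (hσ : 0 < σ) (i : ι) :
    (M *ᵥ h) i < σ * h i :=
  (hMh i).trans_lt (mul_pos hσ (hh i))

variable [DecidableEq ι]

theorem IsMetzler.greenMatrix_mul_exp_diag_le (hM : IsMetzler M) (hh : ∀ i, 0 < h i)
    (hMh : M *ᵥ h ≤ 0) (hσ : 0 < σ) (ht : 0 ≤ t) (i : ι) :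
    (greenMatrix M σ * NormedSpace.exp (t • M)) i i ≤ greenMatrix M σ i i := by
  set G := greenMatrix M σ
  have hMh' := mulVec_lt_of_nonpos hh hMh hσ
  have h_col : (fun k => G k i) ≤ (G i i / h i) • h := fun k => by
    have := hM.greenMatrix_mul_le hh hMh' k i
    rw [Pi.smul_apply, smul_eq_mul, div_mul_eq_mul_div, le_div_iff₀ (hh i)]
    linarith
  have h_ratio : 0 ≤ G i i / h i := div_nonneg (hM.greenMatrix_nonneg hh hMh' i i) (hh i).le
  rw [← (commute_exp_smul (commute_greenMatrix (hM.mem_resolventSet hh hMh')) t).eq]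
  calc (NormedSpace.exp (t • M) *ᵥ fun k => G k i) i
      ≤ (NormedSpace.exp (t • M) *ᵥ ((G i i / h i) • h)) i :=
        mulVec_mono (hM.exp_smul_nonneg ht) h_col i
    _ = G i i / h i * (NormedSpace.exp (t • M) *ᵥ h) i := by
        rw [Matrix.mulVec_smul, Pi.smul_apply, smul_eq_mul]
    _ ≤ G i i / h i * h i := mul_le_mul_of_nonneg_left (hM.exp_smul_mulVec_le ht hMh i) h_ratio
    _ = G i i := div_mul_cancel₀ _ (hh i).ne'

theorem IsMetzler.greenMatrix_row_drift_le (hM : IsMetzler M) (hh : ∀ i, 0 < h i)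
    (hMh : M *ᵥ h ≤ 0) (hσ : 0 < σ) (ht : 0 ≤ t) (i : ι) :
    ((greenMatrix M σ i ᵥ* NormedSpace.exp (t • M) ᵥ* M) ∘ Subtype.val : {j // j ≠ i} → ℝ) ≤
      ((greenMatrix M σ i ᵥ* NormedSpace.exp (t • M)) ∘ Subtype.val -
        greenMatrix M σ i ∘ Subtype.val) ᵥ* deleteState M i +
      σ • (greenMatrix M σ i ∘ Subtype.val) := by
  have hσM := hM.mem_resolventSet hh (mulVec_lt_of_nonpos hh hMh hσ)
  have h_row : ((greenMatrix M σ i ᵥ* M) ∘ Subtype.val : {j // j ≠ i} → ℝ) =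
      σ • (greenMatrix M σ i ∘ Subtype.val) := greenMatrix_row_vecMul_comp_val hσM i
  have h_diag : (greenMatrix M σ i ᵥ* NormedSpace.exp (t • M)) i • (M i ∘ Subtype.val) ≤
      greenMatrix M σ i i • (M i ∘ Subtype.val : {j // j ≠ i} → ℝ) :=
    smul_le_smul_of_nonneg_right (hM.greenMatrix_mul_exp_diag_le hh hMh hσ ht i)
      fun l => hM i l l.2.symm
  rw [vecMul_comp_val] at h_row
  rw [vecMul_comp_val, ← h_row, Matrix.sub_vecMul, add_comm]
  intro l
  have := h_diag l
  simp only [Pi.add_apply, Pi.sub_apply] at this ⊢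
  linarith

theorem IsMetzler.greenMatrix_row_vecMul_exp_le (hM : IsMetzler M) {i : ι}
    (hσM : σ ∈ resolventSet ℝ M) (hσN : σ ∈ resolventSet ℝ (deleteState M i))
    (hG : 0 ≤ greenMatrix M σ i i) {c : ℝ} {j : {j // j ≠ i}}
    (h_delete : ∀ k, (greenMatrix (deleteState M i) σ * NormedSpace.exp (t • deleteState M i)) k j ≤
      greenMatrix (deleteState M i) σ k j * c) :
    ((greenMatrix M σ i ∘ Subtype.val) ᵥ* NormedSpace.exp (t • deleteState M i)) j ≤
      greenMatrix M σ i j * c := by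
  set N := deleteState M i
  have h_excursion := greenMatrix_row_eq hσM hσN
  calc ((greenMatrix M σ i ∘ Subtype.val) ᵥ* NormedSpace.exp (t • N)) j
      = greenMatrix M σ i i *
          ∑ k : {j // j ≠ i}, M i k * (greenMatrix N σ * NormedSpace.exp (t • N)) k j := by
        rw [h_excursion, Matrix.smul_vecMul, Matrix.vecMul_vecMul]; rfl
    _ ≤ greenMatrix M σ i i * ∑ k : {j // j ≠ i}, M i k * (greenMatrix N σ k j * c) :=
        mul_le_mul_of_nonneg_left (Finset.sum_le_sum fun k _ =>
          mul_le_mul_of_nonneg_left (h_delete k) (hM i k k.2.symm)) hG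
    _ = greenMatrix M σ i j * c := by
        rw [show greenMatrix M σ i j = _ from congrFun h_excursion j, Pi.smul_apply, smul_eq_mul,
          mul_assoc, Matrix.vecMul, dotProduct, Finset.sum_mul]
        simp only [mul_assoc, Function.comp_apply]
        rfl

theorem IsMetzler.greenMatrix_mul_exp_offDiag_le (hM : IsMetzler M) (hh : ∀ i, 0 < h i)
    (hMh : M *ᵥ h ≤ 0) (hσ : 0 < σ) (ht : 0 ≤ t) {i : ι}
    (hσN : σ ∈ resolventSet ℝ (deleteState M i)) (m : ℕ) (j : {j // j ≠ i})
    (h_delete : ∀ s, 0 ≤ s → ∀ k,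
      (greenMatrix (deleteState M i) σ * NormedSpace.exp (s • deleteState M i)) k j ≤
        greenMatrix (deleteState M i) σ k j * expPartialSum m (σ * s)) :
    (greenMatrix M σ * NormedSpace.exp (t • M)) i j ≤
      greenMatrix M σ i j * expPartialSum (m + 1) (σ * t) := by
  have hMh' := mulVec_lt_of_nonpos hh hMh hσ
  have h_source (s : ℝ) (hs : s ∈ Set.Icc 0 t) :
      ((σ • (greenMatrix M σ i ∘ Subtype.val)) ᵥ* NormedSpace.exp (s • deleteState M i)) j ≤
        greenMatrix M σ i j * (expPartialSum m (σ * s) * σ) := by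
    have := hM.greenMatrix_row_vecMul_exp_le (hM.mem_resolventSet hh hMh') hσN
      (hM.greenMatrix_nonneg hh hMh' i i) (h_delete s hs.1)
    rw [Matrix.smul_vecMul, Pi.smul_apply, smul_eq_mul]
    linarith [mul_le_mul_of_nonneg_left this hσ.le]
  have h_deriv (u : ℝ) := (hasDerivAt_pi.2 fun l : {j // j ≠ i} =>
    hasDerivAt_pi.1 (hasDerivAt_vecMul_exp M (greenMatrix M σ i) u) l).sub_const
      (greenMatrix M σ i ∘ Subtype.val)
  have h_deriv_sum (s : ℝ) := (((hasDerivAt_expPartialSum_succ m (σ * s)).comp s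
    (hasDerivAt_const_mul σ)).sub_const 1).const_mul (greenMatrix M σ i j)
  have h_le := (hM.submatrix Subtype.val_injective).apply_le_of_hasDerivAt_le ht h_deriv
    h_deriv_sum (by ext; simp) (by simp [expPartialSum_succ_zero])
    (fun u hu => hM.greenMatrix_row_drift_le hh hMh hσ hu.1 i) h_source
  change _ - greenMatrix M σ i j ≤ greenMatrix M σ i j * (_ - 1) at h_le
  rw [mul_sub, mul_one] at h_le
  exact (sub_le_sub_iff_right _).1 h_le

/-- Induction on the number of states. The diagonal entries do not increase with `t`; off the
diagonal, row `i` is driven by the matrix with state `i` deleted. -/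
theorem IsMetzler.greenMatrix_mul_exp_le (hM : IsMetzler M) (hh : ∀ i, 0 < h i)
    (hMh : M *ᵥ h ≤ 0) (hσ : 0 < σ) (ht : 0 ≤ t) (i j : ι) :
    (greenMatrix M σ * NormedSpace.exp (t • M)) i j ≤
      greenMatrix M σ i j * expPartialSum (Fintype.card ι) (σ * t) := by
  induction hm : Fintype.card ι generalizing ι t with
  | zero => exact ((Fintype.card_eq_zero_iff.1 hm).false i).elim
  | succ m ih =>
    rcases eq_or_ne j i with rfl | hji
    · exact (hM.greenMatrix_mul_exp_diag_le hh hMh hσ ht j).trans <| le_mul_of_one_le_right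
        (hM.greenMatrix_nonneg hh (mulVec_lt_of_nonpos hh hMh hσ) j j)
        (one_le_expPartialSum_succ m (by positivity))
    lift j to {j // j ≠ i} using hji
    have hN : IsMetzler (deleteState M i) := hM.submatrix Subtype.val_injective
    have hh' (k : {j // j ≠ i}) : 0 < (h ∘ Subtype.val) k := hh k
    have hNh : deleteState M i *ᵥ (h ∘ Subtype.val) ≤ 0 := fun k =>
      (hM.submatrix_mulVec_le Subtype.val_injective (fun l => (hh l).le) k).trans (hMh k)
    exact hM.greenMatrix_mul_exp_offDiag_le hh hMh hσ ht
      (hN.mem_resolventSet hh' (mulVec_lt_of_nonpos hh' hNh hσ)) m j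
      fun s hs k => ih hN hh' hNh hs k j (by simp [hm])

/-- The probability that the sum of `m` independent `Exp(σ)` variables exceeds `t`, for `0 ≤ t`. -/
noncomputable def erlangTail (m : ℕ) (σ t : ℝ) : ℝ :=
  Real.exp (-(σ * t)) * expPartialSum m (σ * t)

theorem erlangTail_mono {m p : ℕ} (hmp : m ≤ p) (hσ : 0 ≤ σ) (ht : 0 ≤ t) :
    erlangTail m σ t ≤ erlangTail p σ t :=
  mul_le_mul_of_nonneg_left (expPartialSum_mono (mul_nonneg hσ ht) hmp) (Real.exp_pos _).le

theorem continuous_erlangTail (m : ℕ) (t : ℝ) : Continuous fun σ => erlangTail m σ t := by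
  unfold erlangTail expPartialSum
  fun_prop

variable {A : Matrix ι ι ℝ}

/-- Write `1 = (σ - M)⁻¹ (-A 1)` with `M = A + σ` and apply the bound on `(σ - M)⁻¹ e^{tM}`. -/
theorem IsMetzler.exp_mulVec_one_le_of_mulVec_le (hA : IsMetzler A) (hA₁ : A *ᵥ 1 ≤ 0) (hσ : 0 < σ)
    (hh : ∀ i, 0 < h i) (hAh : A *ᵥ h ≤ -(σ • h)) (ht : 0 ≤ t) (i : ι) :
    (NormedSpace.exp (t • A) *ᵥ 1) i ≤ erlangTail (Fintype.card ι) σ t := by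
  set M := A + σ • (1 : Matrix ι ι ℝ) with hM_def
  set G := greenMatrix M σ
  have hM : IsMetzler M := hA.add_smul_one σ
  have hMh : M *ᵥ h ≤ 0 := by
    rw [Matrix.add_mulVec, Matrix.smul_mulVec, Matrix.one_mulVec]
    simpa using add_le_add_left hAh (σ • h)
  have hσM := hM.mem_resolventSet hh (mulVec_lt_of_nonpos hh hMh hσ)
  have h_exit : G *ᵥ (-(A *ᵥ 1)) = 1 := by
    have hGA : G * (-A) = 1 := by
      rw [show -A = σ • 1 - M by rw [hM_def]; abel, mul_sub, resolvent_mul hσM, mul_smul_comm,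
        mul_one, sub_sub_cancel]
    rw [← Matrix.neg_mulVec, Matrix.mulVec_mulVec, hGA, Matrix.one_mulVec]
  have h_exp : NormedSpace.exp (t • A) = Real.exp (-(σ * t)) • NormedSpace.exp (t • M) := by
    rw [exp_smul_add_smul_one, smul_smul, ← Real.exp_add, mul_comm t σ, neg_add_cancel,
      Real.exp_zero, one_smul]
  have h_bound : (NormedSpace.exp (t • M) *ᵥ 1) i ≤ expPartialSum (Fintype.card ι) (σ * t) :=
    calc (NormedSpace.exp (t • M) *ᵥ 1) i = ((G * NormedSpace.exp (t • M)) *ᵥ (-(A *ᵥ 1))) i := by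
          rw [← (commute_exp_smul (commute_greenMatrix hσM) t).eq, ← Matrix.mulVec_mulVec, h_exit]
      _ ≤ ∑ j, G i j * expPartialSum (Fintype.card ι) (σ * t) * (-(A *ᵥ 1)) j :=
          Finset.sum_le_sum fun j _ => mul_le_mul_of_nonneg_right
            (hM.greenMatrix_mul_exp_le hh hMh hσ ht i j) (neg_nonneg.2 (hA₁ j))
      _ = (G *ᵥ (-(A *ᵥ 1))) i * expPartialSum (Fintype.card ι) (σ * t) := by
          simp only [Matrix.mulVec, dotProduct, Finset.sum_mul, mul_right_comm]
      _ = expPartialSum (Fintype.card ι) (σ * t) := by rw [h_exit, Pi.one_apply, one_mul]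
  rw [h_exp, Matrix.smul_mulVec, Pi.smul_apply, smul_eq_mul]
  exact mul_le_mul_of_nonneg_left h_bound (Real.exp_pos _).le

theorem IsMetzler.exp_mulVec_one_le (hA : IsMetzler A) (hA₁ : A *ᵥ 1 ≤ 0) (hσ : 0 < σ)
    (hσA : σ ≤ -dominatingEigenvalue A) (ht : 0 ≤ t) (i : ι) :
    (NormedSpace.exp (t • A) *ᵥ 1) i ≤ erlangTail (Fintype.card ι) σ t := by
  have h_lim : Tendsto (fun s => erlangTail (Fintype.card ι) s t) (𝓝[<] σ)
      (𝓝 (erlangTail (Fintype.card ι) σ t)) :=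
    (continuous_erlangTail _ t).continuousAt.mono_left nhdsWithin_le_nhds
  refine ge_of_tendsto h_lim ?_
  filter_upwards [Ioo_mem_nhdsLT hσ] with s hs
  obtain ⟨h, hh, hAh⟩ :=
    hA.exists_pos_mulVec_lt_of_dominatingEigenvalue_lt (s := -s) (by linarith [hs.2])
  exact hA.exp_mulVec_one_le_of_mulVec_le hA₁ hs.1 hh
    (fun i => (hAh i).le.trans_eq (neg_mul _ _)) ht i

end ErlangBound

section HalfLine

theorem measure_le_of_measure_Ioi_le {μ ν : Measure ℝ} [NullSingletonClass μ]
    (h : ∀ a, μ (Set.Ioi a) ≤ ν (Set.Ioi a)) {s : Set ℝ} (hs : IsUpperSet s) : μ s ≤ ν s := by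
  rcases s.eq_empty_or_nonempty with rfl | h_nonempty
  · simp
  by_cases h_bdd : BddBelow s
  · have h_Ioi : Set.Ioi (sInf s) ⊆ s := fun x hx => by
      obtain ⟨y, hy, hyx⟩ := (csInf_lt_iff h_bdd h_nonempty).1 hx
      exact hs hyx.le hy
    calc μ s ≤ μ (Set.Ici (sInf s)) := measure_mono fun x hx => csInf_le h_bdd hx
      _ = μ (Set.Ioi (sInf s)) := (measure_congr Ioi_ae_eq_Ici).symm
      _ ≤ ν (Set.Ioi (sInf s)) := h _
      _ ≤ ν s := measure_mono h_Ioi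
  · have h_univ : s = Set.univ := Set.eq_univ_of_forall fun x => by
      obtain ⟨y, hy, hyx⟩ := not_bddBelow_iff.1 h_bdd x
      exact hs hyx.le hy
    have h_union : ⋃ a, Set.Ioi (-(a : ℝ)) = Set.univ :=
      Set.eq_univ_of_forall fun x => Set.mem_iUnion.2 ⟨1 - x, by simp⟩
    have h_mono : Monotone fun a : ℝ => Set.Ioi (-a) :=
      fun a b hab => Set.Ioi_subset_Ioi (neg_le_neg hab)
    rw [h_univ, ← h_union, h_mono.measure_iUnion, h_mono.measure_iUnion]
    exact iSup_mono fun a => h _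

theorem lintegral_mono_of_measure_Ioi_le {μ ν : Measure ℝ} [NullSingletonClass μ]
    (h : ∀ a, μ (Set.Ioi a) ≤ ν (Set.Ioi a)) {g : ℝ → ENNReal} (hg : Monotone g)
    (hg_top : ∀ x, g x ≠ ⊤) : ∫⁻ x, g x ∂μ ≤ ∫⁻ x, g x ∂ν := by
  have hg_mono : Monotone fun x => (g x).toReal :=
    fun x y hxy => ENNReal.toReal_mono (hg_top y) (hg hxy)
  have h_layer (ρ : Measure ℝ) :
      ∫⁻ x, g x ∂ρ = ∫⁻ t in Set.Ioi 0, ρ {x | t < (g x).toReal} := by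
    rw [← lintegral_eq_lintegral_meas_lt ρ (ae_of_all _ fun _ => ENNReal.toReal_nonneg)
      hg_mono.measurable.aemeasurable]
    simp only [ENNReal.ofReal_toReal (hg_top _)]
  rw [h_layer, h_layer]
  exact lintegral_mono fun t => measure_le_of_measure_Ioi_le h
    fun x y hxy (hx : t < _) => hx.trans_le (hg_mono hxy)

/-- The measure on the half-line `[0, ∞)` with density `f`. -/
noncomputable def halfLineMeasure (f : ℝ → ℝ) : Measure ℝ :=
  (volume.restrict (Set.Ici 0)).withDensity fun t => ENNReal.ofReal (f t)

instance nullSingletonClass_halfLineMeasure (f : ℝ → ℝ) :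
    NullSingletonClass (halfLineMeasure f) :=
  inferInstanceAs (NullSingletonClass (Measure.withDensity _ _))

theorem lintegral_halfLineMeasure {f : ℝ → ℝ} (hf : Measurable f) {g : ℝ → ENNReal}
    (hg : Measurable g) :
    ∫⁻ t, g t ∂halfLineMeasure f = ∫⁻ t in Set.Ici 0, ENNReal.ofReal (f t) * g t :=
  lintegral_withDensity_eq_lintegral_mul _ hf.ennreal_ofReal hg

theorem halfLineMeasure_Ioi {f F : ℝ → ℝ} (hF : ∀ t, HasDerivAt F (-f t) t)
    (hf : ∀ t, 0 ≤ t → 0 ≤ f t) (h_lim : Tendsto F atTop (𝓝 0)) (a : ℝ) :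
    halfLineMeasure f (Set.Ioi a) = ENNReal.ofReal (F (a ⊔ 0)) := by
  have hf' (t : ℝ) (ht : t ∈ Set.Ioi (a ⊔ 0)) : 0 ≤ f t := hf t (le_sup_right.trans (le_of_lt ht))
  have h_nonpos (t : ℝ) (ht : t ∈ Set.Ioi (a ⊔ 0)) : -f t ≤ 0 := neg_nonpos.2 (hf' t ht)
  have h_int : IntegrableOn f (Set.Ioi (a ⊔ 0)) := by
    simpa using (integrableOn_Ioi_deriv_of_nonpos' (fun t _ => hF t) h_nonpos h_lim).neg
  have h_val : ∫ t in Set.Ioi (a ⊔ 0), f t = F (a ⊔ 0) := by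
    simpa [integral_neg] using
      integral_Ioi_of_hasDerivAt_of_nonpos' (fun t _ => hF t) h_nonpos h_lim
  rw [halfLineMeasure, ← restrict_Ioi_eq_restrict_Ici, withDensity_apply _ measurableSet_Ioi,
    Measure.restrict_restrict measurableSet_Ioi, Set.Ioi_inter_Ioi, ← h_val,
    ofReal_integral_eq_lintegral_ofReal h_int (ae_restrict_of_forall_mem measurableSet_Ioi hf')]

end HalfLine

section Erlang

theorem hasDerivAt_erlangTail_succ (m : ℕ) (σ t : ℝ) :
    HasDerivAt (erlangTail (m + 1) σ)
      (-(σ * Real.exp (-(σ * t)) * ((σ * t) ^ m / m.factorial))) t := by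
  have h_lin : HasDerivAt (fun u => σ * u) σ t := hasDerivAt_const_mul σ
  refine (h_lin.neg.exp.mul ((hasDerivAt_expPartialSum_succ m (σ * t)).comp t h_lin)).congr_deriv ?_
  simp only [Function.comp_apply, expPartialSum, Finset.sum_range_succ, Pi.neg_apply]
  ring

theorem tendsto_erlangTail (m : ℕ) {σ : ℝ} (hσ : 0 < σ) :
    Tendsto (erlangTail m σ) atTop (𝓝 0) := by
  have h_term (k : ℕ) : Tendsto (fun t => Real.exp (-(σ * t)) * ((σ * t) ^ k / k.factorial))
      atTop (𝓝 0) := by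
    have := ((Real.tendsto_pow_mul_exp_neg_atTop_nhds_zero k).comp
      (tendsto_id.const_mul_atTop hσ)).div_const (k.factorial : ℝ)
    rw [zero_div] at this
    exact this.congr fun t => by simp only [Function.comp_apply, id]; ring
  have h_sum := tendsto_finsetSum (Finset.range m) fun k _ => h_term k
  simp only [← Finset.mul_sum, Finset.sum_const_zero] at h_sum
  exact h_sum

theorem erlangMeasure_succ (m : ℕ) (σ : ℝ) :
    erlangMeasure (m + 1) σ =
      halfLineMeasure fun t => σ * Real.exp (-(σ * t)) * ((σ * t) ^ m / m.factorial) := by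
  rw [erlangMeasure, gammaMeasure, halfLineMeasure, ← withDensity_indicator measurableSet_Ici]
  congr 1
  ext t
  by_cases ht : 0 ≤ t
  · rw [Set.indicator_of_mem (Set.mem_Ici.2 ht), gammaPDF_of_nonneg ht, Real.rpow_natCast,
      Nat.cast_succ, Real.Gamma_nat_eq_factorial, add_sub_cancel_right, Real.rpow_natCast]
    congr 1
    ring
  · rw [Set.indicator_of_notMem (Set.notMem_Ici.2 (not_le.1 ht)), gammaPDF_of_neg (not_le.1 ht)]

theorem erlangMeasure_one (ν : ℝ) : erlangMeasure 1 ν = expMeasure ν := by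
  rw [erlangMeasure, Nat.cast_one, expMeasure]

theorem erlangMeasure_Ioi {p : ℕ} (hp : p ≠ 0) {σ : ℝ} (hσ : 0 < σ) (a : ℝ) :
    erlangMeasure p σ (Set.Ioi a) = ENNReal.ofReal (erlangTail p σ (a ⊔ 0)) := by
  obtain ⟨m, rfl⟩ := Nat.exists_eq_succ_of_ne_zero hp
  rw [erlangMeasure_succ]
  exact halfLineMeasure_Ioi (hasDerivAt_erlangTail_succ m σ) (fun t ht => by positivity)
    (tendsto_erlangTail _ hσ) a

theorem isProbabilityMeasure_erlangMeasure {p : ℕ} (hp : p ≠ 0) {σ : ℝ} (hσ : 0 < σ) :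
    IsProbabilityMeasure (erlangMeasure p σ) :=
  isProbabilityMeasure_gammaMeasure (by positivity) hσ

instance nullSingletonClass_erlangMeasure (p : ℕ) (σ : ℝ) :
    NullSingletonClass (erlangMeasure p σ) :=
  inferInstanceAs (NullSingletonClass (Measure.withDensity _ _))

end Erlang

section Block

variable {ι κ : Type*} [Fintype ι] [Fintype κ] {A : Matrix ι ι ℝ} {D : Matrix ι κ ℝ}

/-- `A` holds the transition rates inside a block of states and `D` those out of it. -/
structure IsBlock (A : Matrix ι ι ℝ) (D : Matrix ι κ ℝ) : Prop where
  isMetzler : IsMetzler A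
  exit_nonneg : ∀ i j, 0 ≤ D i j
  row_sum : A *ᵥ 1 + D *ᵥ 1 = 0

theorem IsBlock.mulVec_one_nonpos (h : IsBlock A D) : A *ᵥ 1 ≤ 0 := fun i => by
  rw [eq_neg_of_add_eq_zero_left h.row_sum, Pi.neg_apply, Pi.zero_apply, neg_nonpos]
  exact Finset.sum_nonneg fun j _ => mul_nonneg (h.exit_nonneg i j) zero_le_one

end Block

section HoldingTime

variable {ι κ : Type*} [Fintype ι] [DecidableEq ι] {A : Matrix ι ι ℝ} {D : Matrix ι κ ℝ}
  {v : ι → ℝ} {ν σ t : ℝ}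

/-- The unnormalised law `v e^{tA}` of the state after a time `t` spent in a block entered with law
`v`, pushed forward by the exit matrix `D`. -/
noncomputable def blockStep (A : Matrix ι ι ℝ) (D : Matrix ι κ ℝ) (v : ι → ℝ) (t : ℝ) : κ → ℝ :=
  v ᵥ* NormedSpace.exp (t • A) ᵥ* D

/-- The probability of spending more than a time `t` in a block entered with law `v`. -/
noncomputable def survival (A : Matrix ι ι ℝ) (v : ι → ℝ) (t : ℝ) : ℝ :=
  v ⬝ᵥ (NormedSpace.exp (t • A) *ᵥ 1)

/-- The law of the time spent in a block entered with law `v`; its mass is that of `v`. -/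
noncomputable def blockMeasure [Fintype κ] (A : Matrix ι ι ℝ) (D : Matrix ι κ ℝ) (v : ι → ℝ) :
    Measure ℝ :=
  halfLineMeasure fun t => blockStep A D v t ⬝ᵥ 1

theorem continuous_blockStep (A : Matrix ι ι ℝ) (D : Matrix ι κ ℝ) (v : ι → ℝ) :
    Continuous (blockStep A D v) :=
  (continuous_const.matrix_vecMul (continuous_exp_smul A)).matrix_vecMul continuous_const

theorem lintegral_blockMeasure [Fintype κ] (A : Matrix ι ι ℝ) (D : Matrix ι κ ℝ) (v : ι → ℝ)
    {g : ℝ → ENNReal} (hg : Measurable g) :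
    ∫⁻ t, g t ∂blockMeasure A D v =
      ∫⁻ t in Set.Ici 0, ENNReal.ofReal (blockStep A D v t ⬝ᵥ 1) * g t :=
  lintegral_halfLineMeasure
    ((continuous_blockStep A D v).dotProduct continuous_const).measurable hg

theorem nullSingletonClass_blockMeasure [Fintype κ] (A : Matrix ι ι ℝ) (D : Matrix ι κ ℝ)
    (v : ι → ℝ) : NullSingletonClass (blockMeasure A D v) :=
  inferInstanceAs (NullSingletonClass (halfLineMeasure _))

theorem survival_le_mul {c : ℝ} (hv : 0 ≤ v) (h : ∀ i, (NormedSpace.exp (t • A) *ᵥ 1) i ≤ c) :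
    survival A v t ≤ v ⬝ᵥ 1 * c := by
  have h_const : NormedSpace.exp (t • A) *ᵥ 1 ≤ fun _ => c := h
  simpa [dotProduct, Finset.sum_mul, survival] using
    dotProduct_le_dotProduct_of_nonneg_left h_const hv

theorem mul_le_survival {c : ℝ} (hv : 0 ≤ v) (h : ∀ i, c ≤ (NormedSpace.exp (t • A) *ᵥ 1) i) :
    v ⬝ᵥ 1 * c ≤ survival A v t := by
  have h_const : (fun _ => c) ≤ NormedSpace.exp (t • A) *ᵥ 1 := h
  simpa [dotProduct, Finset.sum_mul, survival] using
    dotProduct_le_dotProduct_of_nonneg_left h_const hv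

theorem IsMetzler.survival_nonneg (hA : IsMetzler A) (hv : 0 ≤ v) (ht : 0 ≤ t) :
    0 ≤ survival A v t := by
  simpa using mul_le_survival (c := 0) hv fun i =>
    Finset.sum_nonneg fun j _ => mul_nonneg (hA.exp_smul_nonneg ht i j) zero_le_one

theorem IsMetzler.exp_neg_le_exp_mulVec_one (hA : IsMetzler A) (hν : ∀ i, (-(A *ᵥ 1)) i ≤ ν)
    (ht : 0 ≤ t) (i : ι) : Real.exp (-(ν * t)) ≤ (NormedSpace.exp (t • A) *ᵥ 1) i := by
  have h_shift : 0 ≤ (A + ν • (1 : Matrix ι ι ℝ)) *ᵥ 1 := fun i => by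
    have := hν i
    simp only [Matrix.add_mulVec, Matrix.smul_mulVec, Matrix.one_mulVec, Pi.add_apply,
      Pi.smul_apply, Pi.one_apply, Pi.zero_apply, Pi.neg_apply, smul_eq_mul, mul_one] at this ⊢
    linarith
  have h_le := (hA.add_smul_one ν).le_exp_smul_mulVec ht h_shift i
  rw [exp_smul_add_smul_one, Matrix.smul_mulVec, Pi.smul_apply, smul_eq_mul, Pi.one_apply,
    mul_comm t] at h_le
  rwa [Real.exp_neg, inv_le_iff_one_le_mul₀' (Real.exp_pos _)]

variable [Fintype κ]

namespace IsBlock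

theorem blockStep_nonneg (h : IsBlock A D) (hv : 0 ≤ v) (ht : 0 ≤ t) : 0 ≤ blockStep A D v t :=
  fun j => Finset.sum_nonneg fun i _ => mul_nonneg
    (Finset.sum_nonneg fun k _ => mul_nonneg (hv k) (h.isMetzler.exp_smul_nonneg ht k i))
    (h.exit_nonneg i j)

theorem hasDerivAt_survival (h : IsBlock A D) (v : ι → ℝ) (t : ℝ) :
    HasDerivAt (survival A v) (-(blockStep A D v t ⬝ᵥ 1)) t := by
  refine (hasDerivAt_dotProduct (hasDerivAt_const t v)
    (hasDerivAt_exp_mulVec A 1 t)).congr_deriv ?_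
  rw [blockStep, ← Matrix.dotProduct_mulVec, ← Matrix.dotProduct_mulVec,
    eq_neg_of_add_eq_zero_left h.row_sum, Matrix.mulVec_neg, dotProduct_neg, zero_dotProduct,
    zero_add]

theorem tendsto_survival (h : IsBlock A D) (hA : dominatingEigenvalue A < 0) (hv : 0 ≤ v) :
    Tendsto (survival A v) atTop (𝓝 0) := by
  have hσ := neg_pos.2 hA
  refine squeeze_zero' (g := fun t => v ⬝ᵥ 1 * erlangTail _ (-dominatingEigenvalue A) t) ?_ ?_
    (by simpa using (tendsto_erlangTail (Fintype.card ι) hσ).const_mul (v ⬝ᵥ 1))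
  · filter_upwards [eventually_ge_atTop 0] with t ht using h.isMetzler.survival_nonneg hv ht
  · filter_upwards [eventually_ge_atTop 0] with t ht using survival_le_mul hv
      (h.isMetzler.exp_mulVec_one_le h.mulVec_one_nonpos hσ le_rfl ht)

theorem blockMeasure_Ioi (h : IsBlock A D) (hA : dominatingEigenvalue A < 0) (hv : 0 ≤ v) (a : ℝ) :
    blockMeasure A D v (Set.Ioi a) = ENNReal.ofReal (survival A v (a ⊔ 0)) :=
  halfLineMeasure_Ioi (h.hasDerivAt_survival v)
    (fun _ ht => dotProduct_nonneg_of_nonneg (h.blockStep_nonneg hv ht) zero_le_one)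
    (h.tendsto_survival hA hv) a

theorem blockMeasure_Ioi_le (h : IsBlock A D) (hσ : 0 < σ) (hσA : σ ≤ -dominatingEigenvalue A)
    {p : ℕ} (hp : p ≠ 0) (h_card : Fintype.card ι ≤ p) (hv : 0 ≤ v) (a : ℝ) :
    blockMeasure A D v (Set.Ioi a) ≤
      ENNReal.ofReal (v ⬝ᵥ 1) * erlangMeasure p σ (Set.Ioi a) := by
  have ha : 0 ≤ a ⊔ 0 := le_sup_right
  rw [h.blockMeasure_Ioi (by linarith) hv, erlangMeasure_Ioi hp hσ,
    ← ENNReal.ofReal_mul (dotProduct_nonneg_of_nonneg hv zero_le_one)]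
  exact ENNReal.ofReal_le_ofReal <| survival_le_mul hv fun i =>
    (h.isMetzler.exp_mulVec_one_le h.mulVec_one_nonpos hσ hσA ha i).trans
      (erlangTail_mono h_card hσ.le ha)

theorem le_blockMeasure_Ioi (h : IsBlock A D) (hA : dominatingEigenvalue A < 0) (hν : 0 < ν)
    (hνA : ∀ i, (-(A *ᵥ 1)) i ≤ ν) (hv : 0 ≤ v) (a : ℝ) :
    ENNReal.ofReal (v ⬝ᵥ 1) * expMeasure ν (Set.Ioi a) ≤ blockMeasure A D v (Set.Ioi a) := by
  rw [h.blockMeasure_Ioi hA hv, ← erlangMeasure_one, erlangMeasure_Ioi one_ne_zero hν,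
    ← ENNReal.ofReal_mul (dotProduct_nonneg_of_nonneg hv zero_le_one)]
  refine ENNReal.ofReal_le_ofReal <| mul_le_survival hv fun i => ?_
  simpa [erlangTail, expPartialSum] using
    h.isMetzler.exp_neg_le_exp_mulVec_one hνA le_sup_right i

end IsBlock

end HoldingTime

section UpperSet

variable {n : ℕ} {μ ν : Measure (Fin n → ℝ)}

theorem stochLE_of_absolutelyContinuous_left (hμ : μ ≪ volume)
    (h : ∀ Γ, MeasurableSet Γ → IsUpperSet Γ → μ Γ ≤ ν Γ) : StochLE μ ν := fun Γ hΓ =>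
  calc μ Γ = μ (interior Γ) :=
        (measure_congr (hμ.ae_le (interior_ae_eq_of_null_frontier hΓ.null_frontier))).symm
    _ ≤ ν (interior Γ) := h _ isOpen_interior.measurableSet hΓ.interior
    _ ≤ ν Γ := measure_mono interior_subset

theorem stochLE_of_absolutelyContinuous_right (hν : ν ≪ volume)
    (h : ∀ Γ, MeasurableSet Γ → IsUpperSet Γ → μ Γ ≤ ν Γ) : StochLE μ ν := fun Γ hΓ =>
  calc μ Γ ≤ μ (closure Γ) := measure_mono subset_closure
    _ ≤ ν (closure Γ) := h _ isClosed_closure.measurableSet hΓ.closure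
    _ = ν Γ := measure_congr (hν.ae_le (closure_ae_eq_of_null_frontier hΓ.null_frontier))

end UpperSet

section ConsSection

variable {n : ℕ} {Γ : Set (Fin (n + 1) → ℝ)}

/-- The section `{y | (t, y) ∈ Γ}` of a set `Γ ⊆ ℝⁿ⁺¹`. -/
def consSection (Γ : Set (Fin (n + 1) → ℝ)) (t : ℝ) : Set (Fin n → ℝ) :=
  {y | (Fin.cons t y : Fin (n + 1) → ℝ) ∈ Γ}

theorem measurePreserving_finCons (θ : Measure ℝ) [SigmaFinite θ] :
    MeasurePreserving (fun q : ℝ × (Fin n → ℝ) => (Fin.cons q.1 q.2 : Fin (n + 1) → ℝ))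
      (θ.prod (Measure.pi fun _ => θ)) (Measure.pi fun _ => θ) := by
  simpa [Fin.insertNthEquiv, Fin.insertNth_zero', Function.comp_def] using
    (measurePreserving_piFinSuccAbove (fun _ : Fin (n + 1) => θ) 0).symm

theorem measurableSet_consSection (hΓ : MeasurableSet Γ) (t : ℝ) :
    MeasurableSet (consSection Γ t) :=
  ((measurePreserving_finCons volume).measurable.comp measurable_prodMk_left) hΓ

theorem isUpperSet_consSection (hΓ : IsUpperSet Γ) (t : ℝ) : IsUpperSet (consSection Γ t) :=
  fun _ _ hxy hx => hΓ (Fin.cons_le_cons.2 ⟨le_rfl, hxy⟩) hx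

theorem monotone_consSection (hΓ : IsUpperSet Γ) : Monotone (consSection Γ) :=
  fun _ _ hst _ hy => hΓ (Fin.cons_le_cons.2 ⟨hst, le_rfl⟩) hy

theorem pi_eq_lintegral_consSection (θ : Measure ℝ) [SigmaFinite θ] (hΓ : MeasurableSet Γ) :
    Measure.pi (fun _ => θ) Γ = ∫⁻ t, Measure.pi (fun _ => θ) (consSection Γ t) ∂θ := by
  have h_cons := measurePreserving_finCons (n := n) θ
  rw [← h_cons.measure_preimage hΓ.nullMeasurableSet,
    Measure.prod_apply (h_cons.measurable hΓ)]
  rfl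

theorem lintegral_pi_succ (θ : Measure ℝ) [SigmaFinite θ] {f : (Fin (n + 1) → ℝ) → ENNReal}
    (hf : Measurable f) :
    ∫⁻ y, f y ∂Measure.pi (fun _ => θ) =
      ∫⁻ t, ∫⁻ y, f (Fin.cons t y : Fin (n + 1) → ℝ) ∂Measure.pi (fun _ => θ) ∂θ := by
  have h_cons := measurePreserving_finCons (n := n) θ
  rw [← h_cons.lintegral_comp hf]
  exact lintegral_prod _ (hf.comp h_cons.measurable).aemeasurable

end ConsSection

section Density

variable {n : ℕ} {S : Fin (n + 1) → Type*} [∀ k, Fintype (S k)] [∀ k, DecidableEq (S k)]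
  (α : S 0 → ℝ) (A : ∀ k : Fin n, Matrix (S k.castSucc) (S k.castSucc) ℝ)
  (D : ∀ k : Fin n, Matrix (S k.castSucc) (S k.succ) ℝ)

theorem continuous_rowVec (k : Fin (n + 1)) : Continuous fun y => rowVec α A D y k := by
  induction k using Fin.induction with
  | zero => exact continuous_const
  | succ k ih =>
    exact (ih.matrix_vecMul ((continuous_exp_smul (A k)).comp (continuous_apply k))).matrix_vecMul
      continuous_const

theorem measurable_density : Measurable (density α A D) := by
  refine Measurable.ite ?_
    ((continuous_rowVec α A D (Fin.last n)).dotProduct continuous_const).measurable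
    measurable_const
  exact measurableSet_Ici (a := (0 : Fin n → ℝ))

theorem law_absolutelyContinuous : law α A D ≪ volume :=
  withDensity_absolutelyContinuous _ _

end Density

section Disintegration

variable {n : ℕ} {S : Fin (n + 2) → Type*} [∀ k, Fintype (S k)] [∀ k, DecidableEq (S k)]
  (α : S 0 → ℝ) (A : ∀ k : Fin (n + 1), Matrix (S k.castSucc) (S k.castSucc) ℝ)
  (D : ∀ k : Fin (n + 1), Matrix (S k.castSucc) (S k.succ) ℝ)

theorem rowVec_succ (y : Fin (n + 1) → ℝ) (k : Fin (n + 1)) :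
    rowVec α A D y k.succ =
      rowVec (S := fun k => S k.succ) (blockStep (A 0) (D 0) α (y 0)) (fun k => A k.succ)
        (fun k => D k.succ) (Fin.tail y) k := by
  induction k using Fin.induction with
  | zero => rfl
  | succ k ih =>
    change blockStep (A k.succ) (D k.succ) (rowVec α A D y k.castSucc.succ) (y k.succ) = _
    rw [ih]
    rfl

theorem density_cons (t : ℝ) (y : Fin n → ℝ) :
    density α A D (Fin.cons t y : Fin (n + 1) → ℝ) = (Set.Ici 0).indicator (fun t =>
      density (S := fun k => S k.succ) (blockStep (A 0) (D 0) α t) (fun k => A k.succ)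
        (fun k => D k.succ) y) t := by
  have h_rowVec := rowVec_succ α A D (Fin.cons t y) (Fin.last n)
  rw [Fin.cons_zero, Fin.tail_cons] at h_rowVec
  simp only [density, Fin.forall_fin_succ, Fin.cons_zero, Fin.cons_succ, ite_and,
    Set.indicator_apply, Set.mem_Ici, ← h_rowVec]
  rfl

theorem law_succ_apply {Γ : Set (Fin (n + 1) → ℝ)} (hΓ : MeasurableSet Γ) :
    law α A D Γ = ∫⁻ t in Set.Ici 0, law (S := fun k => S k.succ) (blockStep (A 0) (D 0) α t)
      (fun k => A k.succ) (fun k => D k.succ) (consSection Γ t) := by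
  rw [law, withDensity_apply _ hΓ, ← lintegral_indicator hΓ, volume_pi,
    lintegral_pi_succ _ ((measurable_density α A D).ennreal_ofReal.indicator hΓ),
    ← lintegral_indicator measurableSet_Ici]
  refine lintegral_congr fun t => ?_
  have h_section (y : Fin n → ℝ) :
      Γ.indicator (fun y => ENNReal.ofReal (density α A D y)) (Fin.cons t y : Fin (n + 1) → ℝ) =
        (consSection Γ t).indicator (fun y => ENNReal.ofReal (density α A D
          (Fin.cons t y : Fin (n + 1) → ℝ))) y := rfl
  simp only [h_section, density_cons]
  rw [lintegral_indicator (measurableSet_consSection hΓ t)]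
  by_cases ht : t ∈ Set.Ici (0 : ℝ)
  · simp only [Set.indicator_of_mem ht, law,
      withDensity_apply _ (measurableSet_consSection hΓ t), volume_pi]
  · simp only [Set.indicator_of_notMem ht, ENNReal.ofReal_zero, lintegral_zero]

end Disintegration

theorem law_zero {S : Fin 1 → Type*} [∀ k, Fintype (S k)] [∀ k, DecidableEq (S k)] (α : S 0 → ℝ)
    (A : ∀ k : Fin 0, Matrix (S k.castSucc) (S k.castSucc) ℝ)
    (D : ∀ k : Fin 0, Matrix (S k.castSucc) (S k.succ) ℝ) (θ : Measure ℝ) :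
    law α A D = ENNReal.ofReal (α ⬝ᵥ 1) • Measure.pi fun _ => θ := by
  have h_density : density α A D = fun _ => α ⬝ᵥ 1 := by
    ext y
    simp [density, rowVec]
  rw [law, h_density, withDensity_const, volume_pi, Measure.pi_of_empty, Measure.pi_of_empty]

section Comparison

variable {n : ℕ} {S : Fin (n + 1) → Type*} [∀ k, Fintype (S k)] [∀ k, DecidableEq (S k)]
  {α : S 0 → ℝ} {A : ∀ k : Fin n, Matrix (S k.castSucc) (S k.castSucc) ℝ}
  {D : ∀ k : Fin n, Matrix (S k.castSucc) (S k.succ) ℝ} {θ : Measure ℝ}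

theorem law_le_pi [IsFiniteMeasure θ] (hα : 0 ≤ α) (hAD : ∀ k, IsBlock (A k) (D k))
    (hθ : ∀ k v, 0 ≤ v → ∀ a, blockMeasure (A k) (D k) v (Set.Ioi a) ≤
      ENNReal.ofReal (v ⬝ᵥ 1) * θ (Set.Ioi a))
    {Γ : Set (Fin n → ℝ)} (hΓm : MeasurableSet Γ) (hΓ : IsUpperSet Γ) :
    law α A D Γ ≤ ENNReal.ofReal (α ⬝ᵥ 1) * Measure.pi (fun _ => θ) Γ := by
  induction n with
  | zero => exact (congrArg (· Γ) (law_zero α A D θ)).le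
  | succ n ih =>
    have h_mono : Monotone fun t => Measure.pi (fun _ => θ) (consSection Γ t) :=
      fun s t hst => measure_mono (monotone_consSection hΓ hst)
    have := nullSingletonClass_blockMeasure (A 0) (D 0) α
    calc law α A D Γ
        ≤ ∫⁻ t in Set.Ici 0, ENNReal.ofReal (blockStep (A 0) (D 0) α t ⬝ᵥ 1) *
            Measure.pi (fun _ => θ) (consSection Γ t) := by
          rw [law_succ_apply α A D hΓm]
          exact setLIntegral_mono' measurableSet_Ici fun t ht => ih
            (S := fun k => S k.succ) ((hAD 0).blockStep_nonneg hα ht) (fun k => hAD k.succ)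
            (fun k => hθ k.succ) (measurableSet_consSection hΓm t) (isUpperSet_consSection hΓ t)
      _ = ∫⁻ t, Measure.pi (fun _ => θ) (consSection Γ t) ∂blockMeasure (A 0) (D 0) α :=
          (lintegral_blockMeasure _ _ _ h_mono.measurable).symm
      _ ≤ ∫⁻ t, Measure.pi (fun _ => θ) (consSection Γ t) ∂(ENNReal.ofReal (α ⬝ᵥ 1) • θ) :=
          lintegral_mono_of_measure_Ioi_le (hθ 0 α hα) h_mono fun _ => measure_ne_top _ _
      _ = ENNReal.ofReal (α ⬝ᵥ 1) * Measure.pi (fun _ => θ) Γ := by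
          rw [lintegral_smul_measure, smul_eq_mul, pi_eq_lintegral_consSection θ hΓm]

theorem pi_le_law [IsFiniteMeasure θ] [NullSingletonClass θ] (hα : 0 ≤ α)
    (hAD : ∀ k, IsBlock (A k) (D k))
    (hθ : ∀ k v, 0 ≤ v → ∀ a, ENNReal.ofReal (v ⬝ᵥ 1) * θ (Set.Ioi a) ≤
      blockMeasure (A k) (D k) v (Set.Ioi a))
    {Γ : Set (Fin n → ℝ)} (hΓm : MeasurableSet Γ) (hΓ : IsUpperSet Γ) :
    ENNReal.ofReal (α ⬝ᵥ 1) * Measure.pi (fun _ => θ) Γ ≤ law α A D Γ := by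
  induction n with
  | zero => exact (congrArg (· Γ) (law_zero α A D θ)).ge
  | succ n ih =>
    have h_mono : Monotone fun t => Measure.pi (fun _ => θ) (consSection Γ t) :=
      fun s t hst => measure_mono (monotone_consSection hΓ hst)
    have : NullSingletonClass (ENNReal.ofReal (α ⬝ᵥ 1) • θ) := ⟨fun x => by simp⟩
    calc ENNReal.ofReal (α ⬝ᵥ 1) * Measure.pi (fun _ => θ) Γ
        = ∫⁻ t, Measure.pi (fun _ => θ) (consSection Γ t) ∂(ENNReal.ofReal (α ⬝ᵥ 1) • θ) := by
          rw [lintegral_smul_measure, smul_eq_mul, pi_eq_lintegral_consSection θ hΓm]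
      _ ≤ ∫⁻ t, Measure.pi (fun _ => θ) (consSection Γ t) ∂blockMeasure (A 0) (D 0) α :=
          lintegral_mono_of_measure_Ioi_le (hθ 0 α hα) h_mono fun _ => measure_ne_top _ _
      _ = ∫⁻ t in Set.Ici 0, ENNReal.ofReal (blockStep (A 0) (D 0) α t ⬝ᵥ 1) *
            Measure.pi (fun _ => θ) (consSection Γ t) :=
          lintegral_blockMeasure _ _ _ h_mono.measurable
      _ ≤ law α A D Γ := by
          rw [law_succ_apply α A D hΓm]
          exact setLIntegral_mono' measurableSet_Ici fun t ht => ih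
            (S := fun k => S k.succ) ((hAD 0).blockStep_nonneg hα ht) (fun k => hAD k.succ)
            (fun k => hθ k.succ) (measurableSet_consSection hΓm t) (isUpperSet_consSection hΓ t)

end Comparison

section Representation

variable {n : ℕ} {S : Fin (n + 1) → Type*} [∀ k, Fintype (S k)]

theorem exitRate_le_max (A : ∀ k : Fin n, Matrix (S k.castSucc) (S k.castSucc) ℝ) (k : Fin n)
    (i : S k.castSucc) : (-(A k *ᵥ 1)) i ≤ maxExitRate A :=
  le_ciSup (f := fun ki : (k : Fin n) × S k.castSucc => (-(A ki.1 *ᵥ 1)) ki.2)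
    (Set.finite_range _).bddAbove ⟨k, i⟩

theorem card_le_maxDim (S : Fin (n + 1) → Type*) [∀ k, Fintype (S k)] (k : Fin n) :
    Fintype.card (S k.castSucc) ≤ maxDim S :=
  Finset.le_sup (f := fun k : Fin n => Fintype.card (S k.castSucc)) (Finset.mem_univ k)

variable [∀ k, DecidableEq (S k)]
  {α : S 0 → ℝ} {A : ∀ k : Fin n, Matrix (S k.castSucc) (S k.castSucc) ℝ}
  {D : ∀ k : Fin n, Matrix (S k.castSucc) (S k.succ) ℝ}

theorem dominatingEigenvalue_le_max (A : ∀ k : Fin n, Matrix (S k.castSucc) (S k.castSucc) ℝ)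
    (k : Fin n) : dominatingEigenvalue (A k) ≤ maxDominatingEigenvalue A :=
  le_ciSup (f := fun k => dominatingEigenvalue (A k)) (Set.finite_range _).bddAbove k

namespace IsRepresentation

theorem isBlock (h : IsRepresentation α A D) (k : Fin n) : IsBlock (A k) (D k) :=
  ⟨h.offDiag_nonneg k, h.D_nonneg k, h.row_sum k⟩

theorem alpha_dotProduct_one (h : IsRepresentation α A D) : α ⬝ᵥ 1 = 1 := by
  rw [dotProduct_one, h.alpha_sum]

theorem nonempty (h : IsRepresentation α A D) : Nonempty (S 0) := by
  by_contra! h_empty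
  simpa using h.alpha_sum

theorem maxDim_pos (h : IsRepresentation α A D) (hn : 1 ≤ n) : 0 < maxDim S := by
  obtain ⟨n, rfl⟩ := Nat.exists_eq_add_of_le' hn
  have : Nonempty (S (0 : Fin (n + 1)).castSucc) := h.nonempty
  exact Fintype.card_pos.trans_le (card_le_maxDim S 0)

theorem maxExitRate_pos (h : IsRepresentation α A D) (hn : 1 ≤ n)
    (hA : maxDominatingEigenvalue A < 0) : 0 < maxExitRate A := by
  obtain ⟨n, rfl⟩ := Nat.exists_eq_add_of_le' hn
  have : Nonempty (S (0 : Fin (n + 1)).castSucc) := h.nonempty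
  obtain ⟨i, hi⟩ := (h.isBlock 0).isMetzler.exists_exitRate_pos
    ((dominatingEigenvalue_le_max A 0).trans_lt hA)
  exact hi.trans_le (exitRate_le_max A 0 i)

theorem stochLE_law_pi_erlangMeasure (h : IsRepresentation α A D) {p : ℕ} (hp₀ : p ≠ 0)
    (hp : maxDim S ≤ p) {σ : ℝ} (hσ : 0 < σ) (hσA : σ ≤ -maxDominatingEigenvalue A) :
    StochLE (law α A D) (Measure.pi fun _ => erlangMeasure p σ) := by
  have := isProbabilityMeasure_erlangMeasure hp₀ hσ
  refine stochLE_of_absolutelyContinuous_left (law_absolutelyContinuous α A D) fun Γ hΓm hΓ => ?_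
  simpa [h.alpha_dotProduct_one] using law_le_pi (θ := erlangMeasure p σ) h.alpha_nonneg h.isBlock
    (fun k v hv => (h.isBlock k).blockMeasure_Ioi_le hσ
      (hσA.trans (neg_le_neg (dominatingEigenvalue_le_max A k))) hp₀
      ((card_le_maxDim S k).trans hp) hv) hΓm hΓ

theorem stochLE_pi_expMeasure_law (h : IsRepresentation α A D)
    (hA : maxDominatingEigenvalue A < 0) {ν : ℝ} (hν₀ : 0 < ν) (hν : maxExitRate A ≤ ν) :
    StochLE (Measure.pi fun _ => expMeasure ν) (law α A D) := by
  have := isProbabilityMeasure_expMeasure hν₀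
  have : NullSingletonClass (expMeasure ν) := erlangMeasure_one ν ▸ inferInstance
  refine stochLE_of_absolutelyContinuous_right (law_absolutelyContinuous α A D) fun Γ hΓm hΓ => ?_
  simpa [h.alpha_dotProduct_one] using pi_le_law (θ := expMeasure ν) h.alpha_nonneg h.isBlock
    (fun k v hv => (h.isBlock k).le_blockMeasure_Ioi ((dominatingEigenvalue_le_max A k).trans_lt hA)
      hν₀ (fun i => (exitRate_le_max A k i).trans hν) hv) hΓm hΓ

end IsRepresentation

end Representation

end MultPH

theorem mainTheorem7 {n : ℕ} (hn : 1 ≤ n) {S : Fin (n + 1) → Type*}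
    [∀ k, Fintype (S k)] [∀ k, DecidableEq (S k)]
    (α : S 0 → ℝ) (A : ∀ k : Fin n, Matrix (S k.castSucc) (S k.castSucc) ℝ)
    (D : ∀ k : Fin n, Matrix (S k.castSucc) (S k.succ) ℝ)
    (hrep : MultPH.IsRepresentation α A D)
    (ν : ℝ) (hν : MultPH.maxExitRate A ≤ ν)
    (p : ℕ) (hp : MultPH.maxDim S ≤ p)
    (σ : ℝ) (hσ : 0 < σ) (hσn : σ ≤ -MultPH.maxDominatingEigenvalue A)
    {ΩY ΩL ΩH : Type*} [MeasurableSpace ΩY] [MeasurableSpace ΩL] [MeasurableSpace ΩH]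
    (PY : Measure ΩY) (PL : Measure ΩL) (PH : Measure ΩH)
    [IsProbabilityMeasure PY] [IsProbabilityMeasure PL] [IsProbabilityMeasure PH]
    (Y : ΩY → Fin n → ℝ) (L : ΩL → Fin n → ℝ) (H : ΩH → Fin n → ℝ)
    (hY : HasLaw Y (MultPH.law α A D) PY)
    (hLlaw : ∀ k, HasLaw (fun ω => L ω k) (expMeasure ν) PL)
    (hLindep : iIndepFun (fun k ω => L ω k) PL)
    (hHlaw : ∀ k, HasLaw (fun ω => H ω k) (MultPH.erlangMeasure p σ) PH)
    (hHindep : iIndepFun (fun k ω => H ω k) PH) :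
    MultPH.StochLE (PL.map L) (PY.map Y) ∧ MultPH.StochLE (PY.map Y) (PH.map H) := by
  have hA : MultPH.maxDominatingEigenvalue A < 0 := by linarith
  have hν₀ : 0 < ν := (hrep.maxExitRate_pos hn hA).trans_le hν
  have hp₀ : p ≠ 0 := ((hrep.maxDim_pos hn).trans_le hp).ne'
  have hL : PL.map L = Measure.pi fun _ => expMeasure ν := (hLindep.hasLaw_pi hLlaw).map_eq
  have hH : PH.map H = Measure.pi fun _ => MultPH.erlangMeasure p σ :=
    (hHindep.hasLaw_pi hHlaw).map_eq
  rw [hL, hY.map_eq, hH]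
  exact ⟨hrep.stochLE_pi_expMeasure_law hA hν₀ hν,
    hrep.stochLE_law_pi_erlangMeasure hp₀ hp hσ hσn⟩
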